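/- Let $S$ be a finite set with a total order $<$, let $R$ be a commutative ring with $1$, let $q\in R$, and let $A=R\langle t_s\mid s\in S\rangle$ be the free associative algebra. Monomials of $A$ are compared by the degree-lexicographic order: $t_{i_1}\cdots t_{i_k}$ precedes $t_{j_1}\cdots t_{j_l}$ if and only if $k<l$, or $k=l$ and $i_h<j_h$ at the first position $h$ at which the two words differ. For $J=\{j_1<\cdots<j_n\}\subseteq S$ put $t_J=t_{j_1}\cdots t_{j_n}$, and write $K<_{\mathrm{dlex}}J$ if $t_K$ precedes $t_J$. For $I=\{j_{\alpha_1}<\cdots<j_{\alpha_m}\}\subseteq J$ put $\ell_J(I)=\sum_{\nu=1}^{m}(\alpha_\nu-\nu)$, and let $$t^-_J=\sum_{I\subseteq J,\ \#I\text{ odd}}(-1)^{\ell_J(I)}(-q)^{(\#I-1)/2}\,t_{J\setminus I}.$$ For a set $\mathfrak N$ of subsets of $S$ let $G_q(\mathfrak N)\subseteq A$ consist of the elements $t_s^2-q$ ($s\in S$), $t_rt_s+t_st_r-2q$ ($r,s\in S$, $s<r$) and $t^-_J$ ($J\in\mathfrak N$), and let $I_q(\mathfrak N)$ be the two-sided ideal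 of $A$ generated by $G_q(\mathfrak N)$. Let $\mathfrak M$ be the set of circuits of a matroid with ground set $S$ that has no loops and no parallel elements. A subset of $S$ is called dependent if it contains a member of $\mathfrak M$. A subset $K\subseteq J$ is called convex in $J$, written $K\sqsubseteq J$, if $j\in K$ for all $j\in J$ such that $k<j<k'$ for some $k,k'\in K$. The set $\overline{\mathfrak M}$ of Gröbner circuits of $\mathfrak M$ is defined recursively along $<_{\mathrm{dlex}}$: a dependent set $J$ belongs to $\overline{\mathfrak M}$ if and only if there is no $K\in\overline{\mathfrak M}$ with $K<_{\mathrm{dlex}}J$ and $K\setminus\{\min K\}\sqsubseteq J\setminus\{\min J\}$. Theorem. We have $I_q(\mathfrak M)=I_q(\overline{\mathfrak M})$, and $G_q(\overline{\mathfrak M})$ is a Gröbner basis of $I_q(\mathfrak M)$ with respect to the degree-lexicographic order; that is, $G_q(\overline{\mathfrak M})\subseteq I_q(\mathfrak M)$, and the two-sided ideal generated by the leading terms (leading coefficient times leading monomial) of the nonzero elements of $G_q(\overline{\mathfrak M})$ coincides with the two-sided ideal generated by the leading terms of the nonzero elements of $I_q(\mathfrak M)$. -/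

import Mathlib

namespace OrlikSolomon

universe u v

/-- `J` is dependent in the set system `𝔐`: it contains a member of `𝔐`. -/
def IsDependent {S : Type u} (𝔐 : Set (Finset S)) (J : Finset S) : Prop :=
  ∃ C ∈ 𝔐, C ⊆ J

section Combinatorics

variable {S : Type u} [LinearOrder S]

/-- The strict degree lexicographic order on words. -/
def WordLT (u w : FreeMonoid S) : Prop :=
  List.Shortlex (· < ·) (FreeMonoid.toList u) (FreeMonoid.toList w)

/-- The word `j₁ j₂ ⋯ jₙ` attached to the finite set `J = {j₁ < j₂ < ⋯ < jₙ}`. -/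
def word (J : Finset S) : FreeMonoid S :=
  FreeMonoid.ofList (J.sort (· ≤ ·))

/-- The strict degree lexicographic order on finite subsets of `S`, induced by that on words. -/
def SetLT (J K : Finset S) : Prop := WordLT (word J) (word K)

/-- `J ∖ {j₁}`, where `j₁` is the least element of `J` (and `∅` if `J = ∅`). -/
def dropMin (J : Finset S) : Finset S := {j ∈ J | ∃ i ∈ J, i < j}

/-- `K` is a convex subset of `J`. -/
def IsConvexSubset (K J : Finset S) : Prop :=
  K ⊆ J ∧ ∀ j ∈ J, ∀ k ∈ K, ∀ k' ∈ K, k < j → j < k' → j ∈ K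

/-- `ℓ_J(I) = ∑_ν (α_ν - ν)` for `I = {j_{α_1} < j_{α_2} < ⋯} ⊆ J = {j_1 < j_2 < ⋯}`. For `i ∈ I` the
two cardinalities are the positions, counted from `0`, of `i` in `J` and in `I`; as `I ⊆ J`, the
subtraction of natural numbers does not truncate. -/
def ell (J I : Finset S) : ℕ :=
  ∑ i ∈ I, ({j ∈ J | j < i}.card - {i' ∈ I | i' < i}.card)

theorem setLT_wellFounded [Finite S] : WellFounded (SetLT (S := S)) :=
  InvImage.wf (fun J : Finset S => J.sort (· ≤ ·))
    (List.Shortlex.wf (r := ((· < ·) : S → S → Prop)) wellFounded_lt)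

/-- The Gröbner circuits of the set system `𝔐`, by recursion along the degree lexicographic order:
a dependent set `J` is a Gröbner circuit if and only if no Gröbner circuit `K` that precedes `J`
satisfies that `K ∖ {k₁}` is a convex subset of `J ∖ {j₁}`. -/
def IsGroebnerCircuit [Finite S] (𝔐 : Set (Finset S)) (J : Finset S) : Prop :=
  IsDependent 𝔐 J ∧ ∀ K : Finset S, (_hK : SetLT K J) →
    IsGroebnerCircuit 𝔐 K → ¬ IsConvexSubset (dropMin K) (dropMin J)
termination_by setLT_wellFounded.wrap J
decreasing_by exact _hK

/-- The defining recursion of Gröbner circuits. -/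
theorem isGroebnerCircuit_iff [Finite S] (𝔐 : Set (Finset S)) (J : Finset S) :
    IsGroebnerCircuit 𝔐 J ↔ IsDependent 𝔐 J ∧ ∀ K : Finset S, IsGroebnerCircuit 𝔐 K →
      SetLT K J → ¬ IsConvexSubset (dropMin K) (dropMin J) := by
  rw [IsGroebnerCircuit]
  exact and_congr_right fun _ => forall_congr' fun _ => forall_comm

/-- The set of Gröbner circuits of `𝔐`. -/
def groebnerCircuits [Finite S] (𝔐 : Set (Finset S)) : Set (Finset S) :=
  {J | IsGroebnerCircuit 𝔐 J}

end Combinatorics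

/-- The set of circuits of a matroid, as a set of finite subsets of `S`. -/
def circuits {S : Type u} (M : Matroid S) : Set (Finset S) :=
  {J | M.IsCircuit (J : Set S)}

section Algebra

variable {S : Type u} (R : Type v) [CommRing R]

/-- The monomial `t_{s₁} ⋯ t_{sₙ}` of `R⟨t_s | s ∈ S⟩` attached to the word `s₁ ⋯ sₙ`. -/
noncomputable def monomial : FreeMonoid S →* FreeAlgebra R S :=
  FreeMonoid.lift (FreeAlgebra.ι R)

variable {R}

/-- The coefficient of the monomial `w` in `f`. -/
noncomputable def coefficient (f : FreeAlgebra R S) (w : FreeMonoid S) : R :=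
  (FreeAlgebra.equivMonoidAlgebraFreeMonoid f).coeff w

variable [LinearOrder S]

/-- `t⁻_J = ∑_{I ⊆ J, #I odd} (-1)^{ℓ_J(I)} (-q)^{(#I-1)/2} t_{J ∖ I}`. -/
noncomputable def tMinus (q : R) (J : Finset S) : FreeAlgebra R S :=
  ∑ I ∈ J.powerset with Odd I.card,
    ((-1) ^ ell J I * (-q) ^ ((I.card - 1) / 2)) • monomial R (word (J \ I))

/-- The elements `t_s² - q`, `t_r t_s + t_s t_r - 2q` for `s < r`, and `t⁻_J` for `J ∈ 𝔐`. -/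
def generators (q : R) (𝔐 : Set (Finset S)) : Set (FreeAlgebra R S) :=
  {f | ∃ s : S, f = FreeAlgebra.ι R s ^ 2 - algebraMap R (FreeAlgebra R S) q} ∪
  {f | ∃ r s : S, s < r ∧ f = FreeAlgebra.ι R r * FreeAlgebra.ι R s +
    FreeAlgebra.ι R s * FreeAlgebra.ι R r - algebraMap R (FreeAlgebra R S) (2 * q)} ∪
  {f | ∃ J ∈ 𝔐, f = tMinus q J}

/-- The two-sided ideal `I_q(𝔐)`. -/
def idealI (q : R) (𝔐 : Set (Finset S)) : TwoSidedIdeal (FreeAlgebra R S) :=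
  TwoSidedIdeal.span (generators q 𝔐)

/-- `m` is the leading monomial of `f` for the degree lexicographic order (so `f ≠ 0`). -/
def IsLeadingMonomial (f : FreeAlgebra R S) (m : FreeMonoid S) : Prop :=
  coefficient f m ≠ 0 ∧ ∀ w, coefficient f w ≠ 0 → w ≠ m → WordLT w m

/-- The leading terms (leading coefficient times leading monomial) of the nonzero elements of a
set of noncommutative polynomials. -/
def leadingTerms (F : Set (FreeAlgebra R S)) : Set (FreeAlgebra R S) :=
  {x | ∃ f ∈ F, ∃ m, IsLeadingMonomial f m ∧ x = coefficient f m • monomial R m}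

/-- `G` is a Gröbner basis of the two-sided ideal `I` for the degree lexicographic order. -/
def IsGroebnerBasis (G : Set (FreeAlgebra R S)) (I : TwoSidedIdeal (FreeAlgebra R S)) : Prop :=
  G ⊆ (I : Set (FreeAlgebra R S)) ∧
    TwoSidedIdeal.span (leadingTerms G) =
      TwoSidedIdeal.span (leadingTerms (I : Set (FreeAlgebra R S)))

end Algebra

end OrlikSolomon

/-!
Let `A` be the free algebra and call a family `x_s` in an `R`-algebra a Clifford family if
`x_s² = q` and `x_r x_s + x_s x_r = 2q`. Over a Clifford family, differences anticommute with all
`x_s`, and `t⁻_J` becomes the product of the consecutive differences of the `x_j`, `j ∈ J`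
(`IsCliffordFamily.snd_signedPair_cons_cons`). Hence `t⁻_J` depends on the order of `J` only by a
sign, it is a multiple of `t⁻_K` for each nonempty `K ⊆ J`, it vanishes if two of the `x_j` agree,
and it is a linear combination of the `t⁻` of the sets `(J ∖ {j}) ∪ {k}` for any further index `k`.

*Equality of the ideals.* As `t⁻_J` is a multiple of `t⁻_C` for each circuit `C ⊆ J`, it lies in
`I_q(𝔐)` for all dependent `J`. Conversely, if `t⁻_K = 0` for all Gröbner circuits `K`, then
`t⁻_J = 0` for all dependent `J`, by induction along the order, using the exchange relation and
circuit elimination (`IsCliffordFamily.snd_signedPair_eq_zero_of_isDependent`).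

*Gröbner basis.* A word that is divisible by no leading monomial of a generator is strictly
increasing, hence is the word of a set `K`, and `K` contains no broken circuit `C ∖ {min C}`
(`exists_leadingMonomial_dvd_or_hasNoBrokenCircuit`). It has to be shown that such a word is not the
leading monomial of an element of the ideal; no reduction process is needed for that, as there is a
linear functional that vanishes on the ideal and on all words smaller than that of `K`, but not on
the latter (`HasNoBrokenCircuit.not_isLeadingMonomial`). For `k ∈ K` let `F_k` be the flat spanned by
the elements of `K` that are at least `k`; since `K` contains no broken circuit, `k = min F_k`. The
strata of this chain of flats partition the ground set, and each circuit has two elements in one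
stratum. So sending `t_s` to a generator that depends only on the stratum of `s` defines a
homomorphism from `A` to a Clifford algebra that kills `I_q(𝔐)`. Contracting with the functionals
dual to the generators indexed by `K` kills the words without a letter in some of these strata, and
by `k = min F_k` the word of `K` is the least word with a letter in each of them.
-/

namespace OrlikSolomon

/-! ### Clifford families and the elements `t⁻_J` attached to lists -/

/-- A family of elements of an `R`-algebra that satisfies the relations `x_s² = q` and
`x_r x_s + x_s x_r = 2q`. The latter is required for `r = s` as well, where it follows from the
former. -/
structure IsCliffordFamily {S R B : Type*} [CommRing R] [Ring B] [Algebra R B]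
    (q : R) (x : S → B) : Prop where
  sq : ∀ s, x s * x s = q • (1 : B)
  anticomm : ∀ r s, x r * x s + x s * x r = (2 * q) • (1 : B)

section SignedPair

variable {S R B : Type*} [CommRing R] [Ring B] [Algebra R B]

/-- The pair `(t⁺_L, t⁻_L)` attached to a list `L` of indices, by recursion on `L`: here `t⁻_L` is
the alternating sum over the sublists of odd length defining `t⁻_J` (see
`tMinus_eq_signedPair`), and `t⁺_L` is its analogue for sublists of even length. -/
def signedPair (q : R) (x : S → B) : List S → B × B
  | [] => (1, 0)
  | a :: L => (x a * (signedPair q x L).1 - q • (signedPair q x L).2,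
      (signedPair q x L).1 - x a * (signedPair q x L).2)

variable {q : R} {x : S → B}

theorem map_signedPair {B' : Type*} [Ring B'] [Algebra R B'] (f : B →ₐ[R] B') (L : List S) :
    signedPair q (fun s => f (x s)) L =
      (f (signedPair q x L).1, f (signedPair q x L).2) := by
  induction L with
  | nil => simp [signedPair]
  | cons a L ih => simp [signedPair, ih]

/-- Over a Clifford family, reordering a list changes `t⁺` and `t⁻` by a common sign. -/
theorem IsCliffordFamily.signedPair_perm (hx : IsCliffordFamily q x) {L L' : List S}
    (h : L.Perm L') :
    signedPair q x L = signedPair q x L' ∨ signedPair q x L = -signedPair q x L' := by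
  induction h with
  | nil => exact Or.inl rfl
  | cons a _ ih =>
    rcases ih with ih | ih
    · left; simp [signedPair, ih]
    · right
      simp only [signedPair, ih, Prod.fst_neg, Prod.snd_neg, Prod.neg_mk, mul_neg, smul_neg]
      congr 1 <;> abel
  | swap a b L =>
    right
    have key : ∀ y : B, x a * (x b * y) + x b * (x a * y) = (2 * q) • y := fun y => by
      rw [← mul_assoc, ← mul_assoc, ← add_mul, hx.anticomm, smul_mul_assoc, one_mul]
    have k1 := key (signedPair q x L).1
    have k2 := key (signedPair q x L).2
    rw [← eq_sub_iff_add_eq] at k1 k2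
    simp only [signedPair, Prod.neg_mk, mul_sub, mul_smul_comm, k1, k2]
    congr 1 <;> module
  | trans _ _ ih₁ ih₂ =>
    rcases ih₁ with ih₁ | ih₁ <;> rcases ih₂ with ih₂ | ih₂ <;> simp [ih₁, ih₂]

theorem IsCliffordFamily.snd_signedPair_eq_zero_of_perm (hx : IsCliffordFamily q x)
    {L L' : List S} (h : L.Perm L') (h0 : (signedPair q x L).2 = 0) :
    (signedPair q x L').2 = 0 := by
  rcases hx.signedPair_perm h.symm with h | h <;> simp [h, h0]

/-- `t⁻_L` is the product of the consecutive differences of the elements indexed by `L`. -/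
theorem IsCliffordFamily.snd_signedPair_cons_cons (hx : IsCliffordFamily q x) (a b : S)
    (L : List S) :
    (signedPair q x (a :: b :: L)).2 = (x b - x a) * (signedPair q x (b :: L)).2 := by
  have h : ∀ y : B, x b * (x b * y) = q • y := fun y => by
    rw [← mul_assoc, hx.sq, smul_mul_assoc, one_mul]
  simp only [signedPair, mul_sub, sub_mul, h]
  abel

theorem IsCliffordFamily.snd_signedPair_append_eq_zero (hx : IsCliffordFamily q x)
    {L : List S} (hL : L ≠ []) (h0 : (signedPair q x L).2 = 0) (L' : List S) :
    (signedPair q x (L' ++ L)).2 = 0 := by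
  induction L' with
  | nil => exact h0
  | cons a L' ih =>
    obtain ⟨b, M, hM⟩ := List.exists_cons_of_ne_nil (List.append_ne_nil_of_right_ne_nil L' hL)
    rw [hM] at ih
    rw [List.cons_append, hM, hx.snd_signedPair_cons_cons, ih, mul_zero]

/-- The exchange relation: `t⁻_L` is a linear combination of the elements obtained from it by
replacing one member of `L` by a further index `k`. -/
theorem IsCliffordFamily.snd_signedPair_mem_span (hx : IsCliffordFamily q x) (k : S)
    (L : List S) :
    (signedPair q x L).2 ∈ Submodule.span R
      {y | ∃ j L', L.Perm (j :: L') ∧ y = (signedPair q x (k :: L')).2} := by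
  induction L with
  | nil => simp [signedPair]
  | cons b L ih =>
    cases L with
    | nil =>
      refine Submodule.subset_span ⟨b, [], List.Perm.refl _, ?_⟩
      simp [signedPair]
    | cons c L =>
      have hdec : (signedPair q x (b :: c :: L)).2 =
          (signedPair q x (k :: c :: L)).2 - (x b - x k) * (signedPair q x (c :: L)).2 := by
        rw [hx.snd_signedPair_cons_cons, hx.snd_signedPair_cons_cons]
        noncomm_ring
      rw [hdec]
      refine sub_mem (Submodule.subset_span ⟨b, c :: L, List.Perm.refl _, rfl⟩) ?_
      have hle := Submodule.mem_map_of_mem (f := LinearMap.mulLeft R (x b - x k)) ih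
      rw [Submodule.map_span] at hle
      refine Submodule.span_mono ?_ hle
      rintro _ ⟨_, ⟨j, L', hperm, rfl⟩, rfl⟩
      refine ⟨j, b :: L', (hperm.cons b).trans (List.Perm.swap _ _ _), ?_⟩
      have hswap : (signedPair q x (k :: b :: L')).2 = -(signedPair q x (b :: k :: L')).2 := by
        have key : ∀ y : B, x k * (x b * y) = (2 * q) • y - x b * (x k * y) := fun y => by
          rw [eq_sub_iff_add_eq, ← mul_assoc, ← mul_assoc, ← add_mul, hx.anticomm,
            smul_mul_assoc, one_mul]
        simp only [signedPair, mul_sub, mul_smul_comm, key]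
        module
      rw [hswap, hx.snd_signedPair_cons_cons, LinearMap.mulLeft_apply]
      noncomm_ring

end SignedPair

section Finsets

variable {S R B : Type*} [LinearOrder S] [CommRing R] [Ring B] [Algebra R B] {q : R} {x : S → B}

theorem IsCliffordFamily.snd_signedPair_sort_eq_zero_iff (hx : IsCliffordFamily q x)
    {L : List S} (hL : L.Nodup) :
    (signedPair q x (L.toFinset.sort (· ≤ ·))).2 = 0 ↔ (signedPair q x L).2 = 0 := by
  have h : (L.toFinset.sort (· ≤ ·)).Perm L :=
    (Finset.sort_perm_toList _ _).trans (List.toFinset_toList hL)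
  exact ⟨hx.snd_signedPair_eq_zero_of_perm h, hx.snd_signedPair_eq_zero_of_perm h.symm⟩

/-- For nonempty `K ⊆ J`, the element `t⁻_J` is a multiple of `t⁻_K`. -/
theorem IsCliffordFamily.snd_signedPair_sort_eq_zero_of_subset (hx : IsCliffordFamily q x)
    {K J : Finset S} (hK : K.Nonempty) (hKJ : K ⊆ J)
    (h0 : (signedPair q x (K.sort (· ≤ ·))).2 = 0) :
    (signedPair q x (J.sort (· ≤ ·))).2 = 0 := by
  have hne : K.sort (· ≤ ·) ≠ [] := by
    intro h
    have := congrArg List.length h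
    simp [hK.ne_empty] at this
  have h := hx.snd_signedPair_append_eq_zero hne h0 ((J \ K).sort (· ≤ ·))
  rw [← hx.snd_signedPair_sort_eq_zero_iff] at h
  · simpa [Finset.sdiff_union_of_subset hKJ] using h
  · rw [List.nodup_append']
    refine ⟨Finset.sort_nodup _ _, Finset.sort_nodup _ _, fun a ha hb => ?_⟩
    simp_all

/-- If two elements of a Clifford family agree, then `t⁻_J` vanishes on sets containing both
indices. -/
theorem IsCliffordFamily.snd_signedPair_sort_eq_zero_of_eq (hx : IsCliffordFamily q x)
    {J : Finset S} {c c' : S} (hc : c ∈ J) (hc' : c' ∈ J) (hne : c ≠ c') (h : x c = x c') :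
    (signedPair q x (J.sort (· ≤ ·))).2 = 0 := by
  refine hx.snd_signedPair_sort_eq_zero_of_subset (K := [c, c'].toFinset) ⟨c, by simp⟩ ?_ ?_
  · intro a ha
    simp only [List.mem_toFinset, List.mem_cons, List.not_mem_nil, or_false] at ha
    rcases ha with rfl | rfl <;> assumption
  · rw [hx.snd_signedPair_sort_eq_zero_iff (by simpa using hne), hx.snd_signedPair_cons_cons,
      h, sub_self, zero_mul]

/-- The exchange relation for finite sets. -/
theorem IsCliffordFamily.snd_signedPair_sort_eq_zero_of_exchange (hx : IsCliffordFamily q x)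
    {J : Finset S} {k : S} (hk : k ∉ J)
    (h : ∀ j ∈ J, (signedPair q x ((insert k (J.erase j)).sort (· ≤ ·))).2 = 0) :
    (signedPair q x (J.sort (· ≤ ·))).2 = 0 := by
  have hspan := hx.snd_signedPair_mem_span k (J.sort (· ≤ ·))
  refine (Submodule.mem_bot R).1 (Submodule.span_le.2 ?_ hspan)
  rintro _ ⟨j, L', hperm, rfl⟩
  have hnd : (j :: L').Nodup := hperm.nodup_iff.1 (Finset.sort_nodup _ _)
  have hmem : ∀ a, a ∈ J ↔ a = j ∨ a ∈ L' := fun a => by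
    rw [← Finset.mem_sort (· ≤ ·), hperm.mem_iff, List.mem_cons]
  have hset : (k :: L').toFinset = insert k (J.erase j) := by
    ext a
    have := (List.nodup_cons.1 hnd).1
    simp only [List.mem_toFinset, List.mem_cons, Finset.mem_insert, Finset.mem_erase, hmem]
    refine or_congr_right ⟨fun ha => ⟨?_, Or.inr ha⟩, fun ha => ha.2.resolve_left ha.1⟩
    rintro rfl
    exact this ha
  have hj := h j ((hmem j).2 (Or.inl rfl))
  rw [← hset, hx.snd_signedPair_sort_eq_zero_iff] at hj
  · simpa using hj
  · exact List.nodup_cons.2 ⟨fun hkL => hk ((hmem k).2 (Or.inr hkL)), (List.nodup_cons.1 hnd).2⟩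

end Finsets

/-! ### Words of finite sets and the recursion for `t⁻_J` -/

section Words

variable {S : Type*} [LinearOrder S]

theorem word_injective : Function.Injective (word : Finset S → FreeMonoid S) := fun J K h => by
  have h' : J.sort (· ≤ ·) = K.sort (· ≤ ·) := FreeMonoid.ofList.injective h
  rw [← Finset.sort_toFinset (r := (· ≤ ·)) J, h', Finset.sort_toFinset]

theorem toList_word (J : Finset S) : FreeMonoid.toList (word J) = J.sort (· ≤ ·) := rfl

theorem sort_union_of_lt {J K : Finset S} (h : ∀ a ∈ J, ∀ b ∈ K, a < b) :
    (J ∪ K).sort (· ≤ ·) = J.sort (· ≤ ·) ++ K.sort (· ≤ ·) := by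
  have hnd : (J.sort (· ≤ ·) ++ K.sort (· ≤ ·)).Nodup := by
    rw [List.nodup_append']
    refine ⟨Finset.sort_nodup _ _, Finset.sort_nodup _ _, fun a ha hb => ?_⟩
    exact lt_irrefl a (h a (by simpa using ha) a (by simpa using hb))
  have hpw : (J.sort (· ≤ ·) ++ K.sort (· ≤ ·)).Pairwise (· ≤ ·) := by
    rw [List.pairwise_append]
    refine ⟨Finset.pairwise_sort _ _, Finset.pairwise_sort _ _, fun a ha b hb => ?_⟩
    exact (h a (by simpa using ha) b (by simpa using hb)).le
  have := (List.toFinset_sort (· ≤ ·) hnd).2 hpw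
  rwa [List.toFinset_append, Finset.sort_toFinset, Finset.sort_toFinset] at this

theorem sort_insert_of_lt {a : S} {J : Finset S} (ha : ∀ b ∈ J, a < b) :
    (insert a J).sort (· ≤ ·) = a :: J.sort (· ≤ ·) :=
  Finset.sort_insert (r := (· ≤ ·)) (fun b hb => (ha b hb).le) fun h => lt_irrefl a (ha a h)

theorem word_insert_of_lt {a : S} {J : Finset S} (ha : ∀ b ∈ J, a < b) :
    word (insert a J) = FreeMonoid.of a * word J := by
  apply FreeMonoid.toList.injective
  rw [toList_word, sort_insert_of_lt ha]
  rfl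

theorem setLT_of_card_lt {J K : Finset S} (h : J.card < K.card) : SetLT J K :=
  List.Shortlex.of_length_lt (by simpa [toList_word] using h)

theorem notMem_of_forall_lt {a : S} {J : Finset S} (ha : ∀ b ∈ J, a < b) : a ∉ J :=
  fun h => lt_irrefl a (ha a h)

theorem ell_insert_of_subset {a : S} {J I : Finset S} (ha : ∀ b ∈ J, a < b) (hI : I ⊆ J) :
    ell (insert a J) I = ell J I + I.card := by
  unfold ell
  rw [Finset.card_eq_sum_ones, ← Finset.sum_add_distrib]
  refine Finset.sum_congr rfl fun i hi => ?_
  have h1 : ({j ∈ insert a J | j < i} : Finset S) = insert a {j ∈ J | j < i} := by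
    rw [Finset.filter_insert, if_pos (ha i (hI hi))]
  have h2 : a ∉ ({j ∈ J | j < i} : Finset S) := fun h =>
    notMem_of_forall_lt ha (Finset.mem_filter.1 h).1
  have h3 : ({j ∈ I | j < i} : Finset S).card ≤ ({j ∈ J | j < i} : Finset S).card :=
    Finset.card_le_card (Finset.filter_subset_filter _ hI)
  rw [h1, Finset.card_insert_of_notMem h2]
  omega

theorem ell_insert_insert {a : S} {J I : Finset S} (ha : ∀ b ∈ J, a < b) (hI : I ⊆ J) :
    ell (insert a J) (insert a I) = ell J I := by
  unfold ell
  have haI : a ∉ I := fun h => notMem_of_forall_lt ha (hI h)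
  rw [Finset.sum_insert haI]
  have h0 : ({j ∈ insert a J | j < a} : Finset S) = ∅ := by
    refine Finset.filter_eq_empty_iff.2 fun j hj => ?_
    rcases Finset.mem_insert.1 hj with rfl | hj
    · exact lt_irrefl _
    · exact (ha j hj).not_gt
  rw [h0, Finset.card_empty, Nat.zero_sub, zero_add]
  refine Finset.sum_congr rfl fun i hi => ?_
  have hcard : ∀ T : Finset S, T ⊆ J →
      ({j ∈ insert a T | j < i} : Finset S).card = ({j ∈ T | j < i} : Finset S).card + 1 := by
    intro T hT
    rw [Finset.filter_insert, if_pos (ha i (hI hi)), Finset.card_insert_of_notMem]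
    exact fun h => notMem_of_forall_lt ha (hT (Finset.mem_filter.1 h).1)
  rw [hcard J subset_rfl, hcard I hI]
  omega

end Words

theorem monomial_of_mul {S R : Type*} [CommRing R] (a : S) (w : FreeMonoid S) :
    monomial R (FreeMonoid.of a * w) = FreeAlgebra.ι R a * monomial R w := by
  simp [monomial]

section Recursion

variable {S R : Type*} [LinearOrder S] [CommRing R]

/-- The analogue `t⁺_J = ∑_{I ⊆ J, #I even} (-1)^{ℓ_J(I)} (-q)^{#I/2} t_{J ∖ I}` of `t⁻_J`. -/
noncomputable def tPlus (q : R) (J : Finset S) : FreeAlgebra R S :=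
  ∑ I ∈ J.powerset with Even I.card,
    ((-1) ^ ell J I * (-q) ^ (I.card / 2)) • monomial R (word (J \ I))

theorem monomial_word_insert_sdiff {a : S} {J I : Finset S} (ha : ∀ b ∈ J, a < b) (hI : I ⊆ J) :
    monomial R (word (insert a J \ I)) = FreeAlgebra.ι R a * monomial R (word (J \ I)) := by
  rw [Finset.insert_sdiff_of_notMem _ fun h => notMem_of_forall_lt ha (hI h),
    word_insert_of_lt fun b hb => ha b (Finset.mem_sdiff.1 hb).1, monomial_of_mul]

theorem word_insert_sdiff_insert {a : S} {J I : Finset S} (ha : ∀ b ∈ J, a < b) :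
    word (insert a J \ insert a I) = word (J \ I) := by
  congr 1
  ext b
  simp only [Finset.mem_sdiff, Finset.mem_insert, not_or]
  exact ⟨fun h => ⟨h.1.resolve_left h.2.1, h.2.2⟩,
    fun h => ⟨Or.inr h.1, fun e => notMem_of_forall_lt ha (e ▸ h.1), h.2⟩⟩

theorem tMinus_insert (q : R) {a : S} {J : Finset S} (ha : ∀ b ∈ J, a < b) :
    tMinus q (insert a J) = tPlus q J - FreeAlgebra.ι R a * tMinus q J := by
  have haJ := notMem_of_forall_lt ha
  unfold tMinus tPlus
  rw [Finset.sum_filter, Finset.sum_powerset_insert haJ, Finset.sum_filter, Finset.sum_filter,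
    Finset.mul_sum, add_comm, sub_eq_add_neg, ← Finset.sum_neg_distrib]
  congr 1 <;> refine Finset.sum_congr rfl fun I hI => ?_
  · have hI := Finset.mem_powerset.1 hI
    have hcard : (insert a I).card = I.card + 1 :=
      Finset.card_insert_of_notMem fun h => haJ (hI h)
    rw [hcard, ell_insert_insert ha hI, word_insert_sdiff_insert ha, Nat.add_sub_cancel]
    simp only [Nat.odd_add_one, Nat.not_odd_iff_even]
  · have hI := Finset.mem_powerset.1 hI
    split_ifs with h
    · rw [ell_insert_of_subset ha hI, monomial_word_insert_sdiff ha hI, pow_add, h.neg_one_pow,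
        mul_smul_comm, ← neg_smul]
      congr 1
      ring
    · simp

theorem tPlus_insert (q : R) {a : S} {J : Finset S} (ha : ∀ b ∈ J, a < b) :
    tPlus q (insert a J) = FreeAlgebra.ι R a * tPlus q J - q • tMinus q J := by
  have haJ := notMem_of_forall_lt ha
  unfold tMinus tPlus
  rw [Finset.sum_filter, Finset.sum_powerset_insert haJ, Finset.sum_filter, Finset.sum_filter,
    Finset.mul_sum, Finset.smul_sum, sub_eq_add_neg, ← Finset.sum_neg_distrib]
  congr 1 <;> refine Finset.sum_congr rfl fun I hI => ?_
  · have hI := Finset.mem_powerset.1 hI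
    split_ifs with h
    · rw [ell_insert_of_subset ha hI, monomial_word_insert_sdiff ha hI, pow_add, h.neg_one_pow,
        mul_smul_comm, mul_one]
    · simp
  · have hI := Finset.mem_powerset.1 hI
    have hcard : (insert a I).card = I.card + 1 :=
      Finset.card_insert_of_notMem fun h => haJ (hI h)
    rw [hcard, ell_insert_insert ha hI, word_insert_sdiff_insert ha]
    simp only [Nat.even_add_one, Nat.not_even_iff_odd]
    split_ifs with h
    · obtain ⟨m, hm⟩ := h
      have h1 : (I.card + 1) / 2 = m + 1 := by omega
      have h2 : (I.card - 1) / 2 = m := by omega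
      rw [h1, h2, smul_smul, ← neg_smul]
      congr 1
      ring
    · simp

/-- In the free algebra itself, `t⁺_J` and `t⁻_J` satisfy the recursion of `signedPair`. -/
theorem signedPair_sort (q : R) (J : Finset S) :
    signedPair q (FreeAlgebra.ι R) (J.sort (· ≤ ·)) = (tPlus q J, tMinus q J) := by
  induction J using Finset.induction_on_min with
  | empty => simp [signedPair, tPlus, tMinus, Finset.filter_singleton, ell, word]
  | insert a J ha ih =>
    rw [sort_insert_of_lt ha, signedPair, ih, tPlus_insert q ha, tMinus_insert q ha]

theorem tMinus_eq_signedPair (q : R) (J : Finset S) :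
    tMinus q J = (signedPair q (FreeAlgebra.ι R) (J.sort (· ≤ ·))).2 := by
  rw [signedPair_sort]

theorem map_tMinus {B : Type*} [Ring B] [Algebra R B] (f : FreeAlgebra R S →ₐ[R] B) (q : R)
    (J : Finset S) :
    f (tMinus q J) = (signedPair q (fun s => f (FreeAlgebra.ι R s)) (J.sort (· ≤ ·))).2 := by
  rw [map_signedPair, ← tMinus_eq_signedPair]

end Recursion

/-! ### Equality of the ideals -/

section Dependent

variable {S : Type*}

theorem IsDependent.mono {𝔐 : Set (Finset S)} {J K : Finset S} (h : IsDependent 𝔐 J)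
    (hJK : J ⊆ K) : IsDependent 𝔐 K :=
  let ⟨C, hC, hCJ⟩ := h
  ⟨C, hC, hCJ.trans hJK⟩

theorem isDependent_of_isCircuit {M : Matroid S} {J : Finset S} {C : Set S} (hC : M.IsCircuit C)
    (hCJ : C ⊆ J) : IsDependent (circuits M) J := by
  have hfin : C.Finite := J.finite_toSet.subset hCJ
  refine ⟨hfin.toFinset, ?_, by simpa using hCJ⟩
  simpa [circuits] using hC

theorem nonempty_of_mem_circuits {M : Matroid S} {C : Finset S} (hC : C ∈ circuits M) :
    C.Nonempty :=
  Finset.coe_nonempty.1 (Matroid.IsCircuit.nonempty hC)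

theorem IsDependent.nonempty {M : Matroid S} {J : Finset S} (h : IsDependent (circuits M) J) :
    J.Nonempty :=
  let ⟨_, hC, hCJ⟩ := h
  (nonempty_of_mem_circuits hC).mono hCJ

end Dependent

section DropMin

variable {S : Type*} [LinearOrder S]

theorem dropMin_subset (J : Finset S) : dropMin J ⊆ J := Finset.filter_subset _ _

theorem dropMin_insert {a : S} {J : Finset S} (ha : ∀ b ∈ J, a < b) :
    dropMin (insert a J) = J := by
  ext b
  simp only [dropMin, Finset.mem_filter, Finset.mem_insert, exists_eq_or_imp]
  constructor
  · rintro ⟨rfl | hb, h⟩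
    · exact absurd h (by rintro (h | ⟨c, hc, h⟩) <;> [exact lt_irrefl _ h; exact h.not_gt (ha c hc)])
    · exact hb
  · exact fun hb => ⟨Or.inr hb, Or.inl (ha b hb)⟩

theorem exists_insert_dropMin {J : Finset S} (hJ : J.Nonempty) :
    ∃ a, (∀ b ∈ dropMin J, a < b) ∧ insert a (dropMin J) = J := by
  have hmin : ∀ b ∈ J.erase (J.min' hJ), J.min' hJ < b := fun b hb =>
    J.min'_lt_of_mem_erase_min' hJ hb
  have h := dropMin_insert hmin
  rw [Finset.insert_erase (J.min'_mem hJ)] at h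
  exact ⟨J.min' hJ, h ▸ hmin, by rw [h, Finset.insert_erase (J.min'_mem hJ)]⟩

/-- Replacing an element of a set by a smaller one moves the set down in the order. -/
theorem setLT_insert_erase {J : Finset S} {j k : S} (hj : j ∈ J) (hk : k ∉ J) (hkj : k < j) :
    SetLT (insert k (J.erase j)) J := by
  have hlow : insert k (J.erase j) =
      {i ∈ J | i < k} ∪ insert k {i ∈ J.erase j | k < i} := by
    ext i
    simp only [Finset.mem_insert, Finset.mem_erase, Finset.mem_union, Finset.mem_filter]
    grind
  have hJ : J = {i ∈ J | i < k} ∪ {i ∈ J | k < i} := by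
    ext i
    simp only [Finset.mem_union, Finset.mem_filter]
    grind
  have hne : ({i ∈ J | k < i} : Finset S).Nonempty := ⟨j, by simp [hj, hkj]⟩
  obtain ⟨h, hh, hins⟩ := exists_insert_dropMin hne
  have hkh : k < h := (Finset.mem_filter.1 (hins ▸ Finset.mem_insert_self h _)).2
  refine List.Shortlex.of_lex ?_ ?_
  · rw [toList_word, toList_word, Finset.length_sort, Finset.length_sort,
      Finset.card_insert_of_notMem (by simp [hk]), Finset.card_erase_add_one hj]
  · rw [toList_word, toList_word, hlow, sort_union_of_lt, sort_insert_of_lt]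
    · conv_rhs => rw [hJ, sort_union_of_lt (by simp; grind), ← hins, sort_insert_of_lt hh]
      exact List.Lex.append_left _ (List.Lex.rel hkh) _
    · simp
    · simp
      grind

end DropMin

theorem mkₐ_eq_zero_iff {S R : Type*} [CommRing R] (I : TwoSidedIdeal (FreeAlgebra R S))
    (a : FreeAlgebra R S) :
    I.ringCon.mkₐ R a = 0 ↔ a ∈ I := by
  conv_rhs => rw [← TwoSidedIdeal.ker_ringCon_mk' I]
  rw [TwoSidedIdeal.mem_ker]
  rfl

section Ideals

variable {S R : Type*} [LinearOrder S] [CommRing R]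

theorem isCliffordFamily_of_map_generators {B : Type*} [Ring B] [Algebra R B] {q : R}
    {𝔐 : Set (Finset S)} (f : FreeAlgebra R S →ₐ[R] B) (h : ∀ g ∈ generators q 𝔐, f g = 0) :
    IsCliffordFamily q fun s => f (FreeAlgebra.ι R s) := by
  have hsq : ∀ s, f (FreeAlgebra.ι R s) * f (FreeAlgebra.ι R s) = q • (1 : B) := fun s => by
    have := h _ (Or.inl (Or.inl ⟨s, rfl⟩))
    rwa [map_sub, map_pow, AlgHom.commutes, sub_eq_zero, pow_two, Algebra.algebraMap_eq_smul_one]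
      at this
  have hlt : ∀ r s, s < r → f (FreeAlgebra.ι R r) * f (FreeAlgebra.ι R s) +
      f (FreeAlgebra.ι R s) * f (FreeAlgebra.ι R r) = (2 * q) • (1 : B) := fun r s hrs => by
    have := h _ (Or.inl (Or.inr ⟨r, s, hrs, rfl⟩))
    rwa [map_sub, map_add, map_mul, map_mul, AlgHom.commutes, sub_eq_zero,
      Algebra.algebraMap_eq_smul_one] at this
  refine ⟨hsq, fun r s => ?_⟩
  rcases lt_trichotomy s r with hrs | rfl | hrs
  · exact hlt r s hrs
  · rw [hsq, ← add_smul, two_mul]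
  · rw [add_comm, hlt s r hrs]

theorem map_mem_generators {B : Type*} [Ring B] [Algebra R B] {q : R}
    {𝔐 : Set (Finset S)} (f : FreeAlgebra R S →ₐ[R] B)
    (hf : IsCliffordFamily q fun s => f (FreeAlgebra.ι R s))
    (h : ∀ J ∈ 𝔐, f (tMinus q J) = 0) : ∀ g ∈ generators q 𝔐, f g = 0 := by
  rintro g ((⟨s, rfl⟩ | ⟨r, s, -, rfl⟩) | ⟨J, hJ, rfl⟩)
  · rw [map_sub, map_pow, AlgHom.commutes, Algebra.algebraMap_eq_smul_one, pow_two, hf.sq, sub_self]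
  · rw [map_sub, map_add, map_mul, map_mul, AlgHom.commutes, Algebra.algebraMap_eq_smul_one,
      hf.anticomm, sub_self]
  · exact h J hJ

theorem map_eq_zero_of_mem_idealI {B : Type*} [Ring B] [Algebra R B] {q : R}
    {𝔐 : Set (Finset S)} (f : FreeAlgebra R S →ₐ[R] B) (h : ∀ g ∈ generators q 𝔐, f g = 0)
    {a : FreeAlgebra R S} (ha : a ∈ idealI q 𝔐) : f a = 0 := by
  have hle : idealI q 𝔐 ≤ TwoSidedIdeal.ker f :=
    TwoSidedIdeal.span_le.2 fun g hg => (TwoSidedIdeal.mem_ker f).2 (h g hg)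
  exact (TwoSidedIdeal.mem_ker f).1 (hle ha)

/-- To compare two ideals `I_q`, it suffices to look at Clifford families. -/
theorem idealI_le {q : R} {𝔐 𝔑 : Set (Finset S)}
    (h : ∀ x : S → (idealI q 𝔑).ringCon.Quotient, IsCliffordFamily q x →
      (∀ J ∈ 𝔑, (signedPair q x (J.sort (· ≤ ·))).2 = 0) →
      ∀ J ∈ 𝔐, (signedPair q x (J.sort (· ≤ ·))).2 = 0) :
    idealI q 𝔐 ≤ idealI q 𝔑 := by
  set f := (idealI q 𝔑).ringCon.mkₐ R
  have hgen : ∀ g ∈ generators q 𝔑, f g = 0 := fun g hg =>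
    (mkₐ_eq_zero_iff _ _).2 (TwoSidedIdeal.subset_span hg)
  have hcl := isCliffordFamily_of_map_generators f hgen
  refine TwoSidedIdeal.span_le.2 fun g hg => (mkₐ_eq_zero_iff _ _).1 ?_
  refine map_mem_generators f hcl (fun J hJ => ?_) g hg
  rw [map_tMinus]
  refine h _ hcl (fun K hK => ?_) J hJ
  rw [← map_tMinus]
  exact hgen _ (Or.inr ⟨K, hK, rfl⟩)

variable [Finite S]

/-- If `t⁻_K` vanishes for all Gröbner circuits `K`, then `t⁻_J` vanishes for all dependent sets
`J`. A dependent set `J` that is not a Gröbner circuit is treated by induction along the degree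
lexicographic order: if `K` is a preceding Gröbner circuit whose tail lies in that of `J`, but whose
least element `k` is not in `J`, then each set `(J ∖ {j}) ∪ {k}` of the exchange relation either
contains `K` or is a preceding dependent set. -/
theorem IsCliffordFamily.snd_signedPair_eq_zero_of_isDependent {M : Matroid S}
    {B : Type*} [Ring B] [Algebra R B] {q : R} {x : S → B} (hx : IsCliffordFamily q x)
    (h : ∀ K ∈ groebnerCircuits (circuits M), (signedPair q x (K.sort (· ≤ ·))).2 = 0)
    (J : Finset S) (hJ : IsDependent (circuits M) J) :
    (signedPair q x (J.sort (· ≤ ·))).2 = 0 := by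
  induction J using (setLT_wellFounded (S := S)).induction with
  | _ J ih =>
  by_cases hG : IsGroebnerCircuit (circuits M) J
  · exact h J hG
  rw [isGroebnerCircuit_iff, not_and] at hG
  have hG := hG hJ
  push Not at hG
  obtain ⟨K, hK, hKJ, hconv⟩ := hG
  have hKdep : IsDependent (circuits M) K := ((isGroebnerCircuit_iff _ _).1 hK).1
  have hK0 := h K hK
  obtain ⟨k, hklt, hkK⟩ := exists_insert_dropMin hKdep.nonempty
  have hsub : dropMin K ⊆ J := hconv.1.trans (dropMin_subset J)
  by_cases hkJ : k ∈ J
  · refine hx.snd_signedPair_sort_eq_zero_of_subset hKdep.nonempty ?_ hK0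
    rw [← hkK]
    exact Finset.insert_subset hkJ hsub
  by_cases htail : IsDependent (circuits M) (dropMin K)
  · refine hx.snd_signedPair_sort_eq_zero_of_subset htail.nonempty hsub (ih _ ?_ htail)
    apply setLT_of_card_lt
    obtain ⟨j, hjlt, hjJ⟩ := exists_insert_dropMin hJ.nonempty
    calc (dropMin K).card ≤ (dropMin J).card := Finset.card_le_card hconv.1
      _ < (insert j (dropMin J)).card := by
        rw [Finset.card_insert_of_notMem (notMem_of_forall_lt hjlt)]
        exact Nat.lt_succ_self _
      _ = J.card := by rw [hjJ]
  refine hx.snd_signedPair_sort_eq_zero_of_exchange hkJ fun j hj => ?_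
  by_cases hjK : j ∈ K
  · have hjtail : j ∈ dropMin K := by
      rw [← hkK] at hjK
      exact (Finset.mem_insert.1 hjK).resolve_left fun e => hkJ (e ▸ hj)
    refine ih _ (setLT_insert_erase hj hkJ (hklt j hjtail)) ?_
    -- `K` and `J` contain distinct circuits, as only the former can contain `k`.
    obtain ⟨C, hC, hCJ⟩ := hJ
    obtain ⟨D, hD, hDK⟩ := hKdep
    have hkD : k ∈ D := by
      by_contra hkD
      refine htail ⟨D, hD, fun a ha => ?_⟩
      have haK := hDK ha
      rw [← hkK] at haK
      exact (Finset.mem_insert.1 haK).resolve_left fun e => hkD (e ▸ ha)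
    have hne : (C : Set S) ≠ D := fun e => hkJ (hCJ (by rwa [← Finset.mem_coe, e]))
    obtain ⟨C', hC'sub, hC'⟩ := Matroid.IsCircuit.elimination hC hD hne j
    refine isDependent_of_isCircuit hC' fun a ha => ?_
    obtain ⟨haCD, haj⟩ := hC'sub ha
    rw [Finset.mem_coe, Finset.mem_insert, Finset.mem_erase]
    rcases haCD with haC | haD
    · exact Or.inr ⟨haj, hCJ haC⟩
    · have haK := hDK haD
      rw [← hkK] at haK
      exact (Finset.mem_insert.1 haK).imp_right fun h => ⟨haj, hsub h⟩
  · refine hx.snd_signedPair_sort_eq_zero_of_subset hKdep.nonempty ?_ hK0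
    intro a ha
    have haK := ha
    rw [← hkK] at haK
    rw [Finset.mem_insert, Finset.mem_erase]
    exact (Finset.mem_insert.1 haK).imp_right fun h => ⟨fun e => hjK (e ▸ ha), hsub h⟩

theorem idealI_circuits_eq_idealI_groebnerCircuits (M : Matroid S) (q : R) :
    idealI q (circuits M) = idealI q (groebnerCircuits (circuits M)) := by
  apply le_antisymm <;> refine idealI_le fun x hx h J hJ => ?_
  · exact hx.snd_signedPair_eq_zero_of_isDependent h J ⟨J, hJ, subset_rfl⟩
  · obtain ⟨C, hC, hCJ⟩ := ((isGroebnerCircuit_iff _ _).1 hJ).1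
    exact hx.snd_signedPair_sort_eq_zero_of_subset (nonempty_of_mem_circuits hC) hCJ (h C hC)

end Ideals

/-! ### Leading monomials of the generators -/

section Coefficient

variable {S R : Type*} [CommRing R]

theorem equivMonoidAlgebraFreeMonoid_monomial (w : FreeMonoid S) :
    FreeAlgebra.equivMonoidAlgebraFreeMonoid (monomial R w) =
      MonoidAlgebra.of R (FreeMonoid S) w := by
  induction w using FreeMonoid.inductionOn' with
  | one => rw [map_one, map_one, map_one]
  | of_mul a w ih =>
    rw [monomial_of_mul, map_mul, ih, map_mul]
    congr 1
    simp [FreeAlgebra.equivMonoidAlgebraFreeMonoid]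

theorem coefficient_monomial [DecidableEq (FreeMonoid S)] (w w' : FreeMonoid S) :
    coefficient (monomial R w) w' = if w = w' then 1 else 0 := by
  rw [coefficient, equivMonoidAlgebraFreeMonoid_monomial]
  simp [MonoidAlgebra.of_apply, Finsupp.single_apply]

theorem coefficient_add (f g : FreeAlgebra R S) (w : FreeMonoid S) :
    coefficient (f + g) w = coefficient f w + coefficient g w := by
  simp [coefficient]

theorem coefficient_sub (f g : FreeAlgebra R S) (w : FreeMonoid S) :
    coefficient (f - g) w = coefficient f w - coefficient g w := by
  simp [coefficient]

theorem coefficient_smul (c : R) (f : FreeAlgebra R S) (w : FreeMonoid S) :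
    coefficient (c • f) w = c * coefficient f w := by
  simp [coefficient]

theorem coefficient_sum {ι : Type*} (s : Finset ι) (f : ι → FreeAlgebra R S) (w : FreeMonoid S) :
    coefficient (∑ i ∈ s, f i) w = ∑ i ∈ s, coefficient (f i) w := by
  simp [coefficient, MonoidAlgebra.coeff_sum]

/-- A noncommutative polynomial is the linear combination of its monomials. -/
theorem exists_eq_sum_coefficient_smul_monomial (f : FreeAlgebra R S) :
    ∃ s : Finset (FreeMonoid S), (∀ w ∉ s, coefficient f w = 0) ∧
      f = ∑ w ∈ s, coefficient f w • monomial R w := by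
  refine ⟨(FreeAlgebra.equivMonoidAlgebraFreeMonoid f).coeff.support,
    fun w hw => Finsupp.notMem_support_iff.1 hw, ?_⟩
  apply (FreeAlgebra.equivMonoidAlgebraFreeMonoid (R := R) (X := S)).injective
  simp only [map_sum, map_smul, equivMonoidAlgebraFreeMonoid_monomial]
  apply MonoidAlgebra.coeff_injective
  classical
  ext w
  simp [MonoidAlgebra.coeff_sum, Finsupp.finsetSum_apply, Finsupp.single_apply, coefficient]

end Coefficient

section Leading

variable {S R : Type*} [LinearOrder S] [CommRing R]

theorem isLeadingMonomial_sq [Nontrivial R] (q : R) (s : S) :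
    IsLeadingMonomial (FreeAlgebra.ι R s ^ 2 - algebraMap R (FreeAlgebra R S) q)
        (FreeMonoid.of s * FreeMonoid.of s) ∧
      coefficient (FreeAlgebra.ι R s ^ 2 - algebraMap R (FreeAlgebra R S) q)
        (FreeMonoid.of s * FreeMonoid.of s) = 1 := by
  classical
  have hf : FreeAlgebra.ι R s ^ 2 - algebraMap R (FreeAlgebra R S) q =
      monomial R (FreeMonoid.of s * FreeMonoid.of s) - q • monomial R 1 := by
    simp [monomial, pow_two, Algebra.algebraMap_eq_smul_one]
  have hlt : WordLT (1 : FreeMonoid S) (FreeMonoid.of s * FreeMonoid.of s) :=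
    List.Shortlex.of_length_lt (by simp)
  have hone : coefficient (FreeAlgebra.ι R s ^ 2 - algebraMap R (FreeAlgebra R S) q)
        (FreeMonoid.of s * FreeMonoid.of s) = 1 := by
    rw [hf, coefficient_sub, coefficient_smul, coefficient_monomial, coefficient_monomial,
      if_pos rfl, if_neg, mul_zero, sub_zero]
    intro h
    simpa using congrArg FreeMonoid.length h
  refine ⟨⟨by rw [hone]; exact one_ne_zero, fun w hw hne => ?_⟩, hone⟩
  rw [hf, coefficient_sub, coefficient_smul, coefficient_monomial, coefficient_monomial,
    if_neg hne.symm] at hw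
  by_cases h1 : 1 = w
  · exact h1 ▸ hlt
  · simp [h1] at hw

theorem isLeadingMonomial_anticomm [Nontrivial R] (q : R) {r s : S} (hsr : s < r) :
    IsLeadingMonomial (FreeAlgebra.ι R r * FreeAlgebra.ι R s +
        FreeAlgebra.ι R s * FreeAlgebra.ι R r - algebraMap R (FreeAlgebra R S) (2 * q))
        (FreeMonoid.of r * FreeMonoid.of s) ∧
      coefficient (FreeAlgebra.ι R r * FreeAlgebra.ι R s +
        FreeAlgebra.ι R s * FreeAlgebra.ι R r - algebraMap R (FreeAlgebra R S) (2 * q))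
        (FreeMonoid.of r * FreeMonoid.of s) = 1 := by
  classical
  have hf : FreeAlgebra.ι R r * FreeAlgebra.ι R s +
        FreeAlgebra.ι R s * FreeAlgebra.ι R r - algebraMap R (FreeAlgebra R S) (2 * q) =
      monomial R (FreeMonoid.of r * FreeMonoid.of s) +
        monomial R (FreeMonoid.of s * FreeMonoid.of r) - (2 * q) • monomial R 1 := by
    simp [monomial, Algebra.algebraMap_eq_smul_one]
  have hlt : WordLT (1 : FreeMonoid S) (FreeMonoid.of r * FreeMonoid.of s) :=
    List.Shortlex.of_length_lt (by simp)
  have hlt' : WordLT (FreeMonoid.of s * FreeMonoid.of r) (FreeMonoid.of r * FreeMonoid.of s) :=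
    List.Shortlex.of_lex (by simp) (List.Lex.rel hsr)
  have hone : coefficient (FreeAlgebra.ι R r * FreeAlgebra.ι R s +
        FreeAlgebra.ι R s * FreeAlgebra.ι R r - algebraMap R (FreeAlgebra R S) (2 * q))
        (FreeMonoid.of r * FreeMonoid.of s) = 1 := by
    rw [hf, coefficient_sub, coefficient_add, coefficient_smul, coefficient_monomial,
      coefficient_monomial, coefficient_monomial, if_pos rfl, if_neg, if_neg, mul_zero, sub_zero,
      add_zero]
    · intro h
      simpa using congrArg FreeMonoid.length h
    · intro h
      have := congrArg FreeMonoid.toList h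
      simp at this
      exact hsr.ne this.1
  refine ⟨⟨by rw [hone]; exact one_ne_zero, fun w hw hne => ?_⟩, hone⟩
  rw [hf, coefficient_sub, coefficient_add, coefficient_smul, coefficient_monomial,
    coefficient_monomial, coefficient_monomial, if_neg hne.symm] at hw
  by_cases h1 : 1 = w
  · exact h1 ▸ hlt
  by_cases h2 : FreeMonoid.of s * FreeMonoid.of r = w
  · exact h2 ▸ hlt'
  · simp [h1, h2] at hw

theorem ell_singleton_of_forall_lt {a : S} {J : Finset S} (ha : ∀ b ∈ J, a < b) :
    ell (insert a J) {a} = 0 := by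
  have h := ell_insert_insert (I := ∅) ha (Finset.empty_subset J)
  simpa [ell] using h

theorem isLeadingMonomial_tMinus [Nontrivial R] (q : R) {J : Finset S} (hJ : J.Nonempty) :
    IsLeadingMonomial (tMinus q J) (word (dropMin J)) ∧
      coefficient (tMinus q J) (word (dropMin J)) = 1 := by
  classical
  obtain ⟨a, ha, haJ⟩ := exists_insert_dropMin hJ
  have hcoef : ∀ w, coefficient (tMinus q J) w = ∑ I ∈ J.powerset with Odd I.card,
      ((-1) ^ ell J I * (-q) ^ ((I.card - 1) / 2)) * if word (J \ I) = w then 1 else 0 :=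
    fun w => by simp only [tMinus, coefficient_sum, coefficient_smul, coefficient_monomial]
  have hsdiff : J \ {a} = dropMin J := by
    nth_rw 1 [← haJ]
    rw [← Finset.erase_eq, Finset.erase_insert (notMem_of_forall_lt ha)]
  have haJ' : a ∈ J := haJ ▸ Finset.mem_insert_self _ _
  have hone : coefficient (tMinus q J) (word (dropMin J)) = 1 := by
    rw [hcoef, Finset.sum_eq_single {a}]
    · have hell : ell J {a} = 0 := by
        have := ell_singleton_of_forall_lt ha
        rwa [haJ] at this
      simp [hsdiff, hell]
    · intro I hI hne
      rw [Finset.mem_filter, Finset.mem_powerset] at hI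
      rw [if_neg, mul_zero]
      intro hw
      refine hne ?_
      have h := word_injective hw
      rw [← hsdiff] at h
      rw [← Finset.sdiff_sdiff_eq_self hI.1, h,
        Finset.sdiff_sdiff_eq_self (Finset.singleton_subset_iff.2 haJ')]
    · intro hn
      exact absurd (by simp [haJ']) hn
  refine ⟨⟨by rw [hone]; exact one_ne_zero, fun w hw hne => ?_⟩, hone⟩
  rw [hcoef] at hw
  obtain ⟨I, hI, hI0⟩ := Finset.exists_ne_zero_of_sum_ne_zero hw
  have hwI : word (J \ I) = w := by
    by_contra h
    simp [h] at hI0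
  subst hwI
  rw [Finset.mem_filter, Finset.mem_powerset] at hI
  obtain ⟨hIJ, hodd⟩ := hI
  have hJcard : J.card = (dropMin J).card + 1 := by
    conv_lhs => rw [← haJ]
    exact Finset.card_insert_of_notMem (notMem_of_forall_lt ha)
  by_cases hI1 : I.card = 1
  · obtain ⟨j, rfl⟩ := Finset.card_eq_one.1 hI1
    have hj : j ∈ J := hIJ (Finset.mem_singleton_self j)
    have hja : j ≠ a := by
      rintro rfl
      exact hne (by rw [hsdiff])
    have hjd : j ∈ dropMin J := by
      rw [← haJ] at hj
      exact (Finset.mem_insert.1 hj).resolve_left hja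
    have heq : J \ {j} = insert a ((dropMin J).erase j) := by
      conv_lhs => rw [← haJ]
      rw [← Finset.erase_eq, Finset.erase_insert_of_ne hja.symm]
    rw [heq]
    exact setLT_insert_erase hjd (notMem_of_forall_lt ha) (ha j hjd)
  · apply setLT_of_card_lt
    have := Finset.card_sdiff_add_card_eq_card hIJ
    have hpos := hodd.pos
    omega

end Leading

/-! ### Words divisible by no leading monomial -/

section Irreducible

variable {S : Type*} [LinearOrder S]

/-- A convex subset of a finite set yields a factor of its word. -/
theorem exists_word_eq_mul_of_isConvexSubset {K J : Finset S} (h : IsConvexSubset K J) :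
    ∃ u v, word J = u * word K * v := by
  rcases K.eq_empty_or_nonempty with rfl | ⟨k₀, hk₀⟩
  · refine ⟨word J, 1, ?_⟩
    have : word (∅ : Finset S) = 1 := by simp [word]
    rw [this, mul_one, mul_one]
  obtain ⟨hKJ, hconv⟩ := h
  have hJ : J = {j ∈ J | ∀ k ∈ K, j < k} ∪ K ∪ {j ∈ J | ∀ k ∈ K, k < j} := by
    ext j
    simp only [Finset.mem_union, Finset.mem_filter]
    constructor
    · intro hj
      by_contra hcon
      push Not at hcon
      obtain ⟨⟨h1, hjK⟩, h2⟩ := hcon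
      obtain ⟨k, hk, hkj⟩ := h1 hj
      obtain ⟨k', hk', hjk'⟩ := h2 hj
      exact hjK (hconv j hj k hk k' hk' (lt_of_le_of_ne hkj fun e => hjK (e ▸ hk))
        (lt_of_le_of_ne hjk' fun e => hjK (e ▸ hk')))
    · rintro ((h | h) | h)
      exacts [h.1, hKJ h, h.1]
  refine ⟨word {j ∈ J | ∀ k ∈ K, j < k}, word {j ∈ J | ∀ k ∈ K, k < j}, ?_⟩
  apply FreeMonoid.toList.injective
  conv_lhs => rw [hJ, toList_word, sort_union_of_lt (by
    intro a ha b hb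
    rw [Finset.mem_filter] at hb
    rcases Finset.mem_union.1 ha with ha | ha
    · exact ((Finset.mem_filter.1 ha).2 k₀ hk₀).trans (hb.2 k₀ hk₀)
    · exact hb.2 a ha), sort_union_of_lt (by
    intro a ha b hb
    exact (Finset.mem_filter.1 ha).2 b hb)]
  rfl

/-- A set containing no broken circuit, that is, not containing `C ∖ {min C}` for any `C` in the
set system `𝔐`. -/
def HasNoBrokenCircuit (𝔐 : Set (Finset S)) (K : Finset S) : Prop :=
  ∀ C ∈ 𝔐, ¬ dropMin C ⊆ K

/-- The tail of a Gröbner circuit occurs as a convex subset in each set containing a broken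
circuit. -/
theorem exists_groebnerCircuit_of_dropMin_subset [Finite S] {M : Matroid S} {C K : Finset S}
    (hC : C ∈ circuits M) (hCK : dropMin C ⊆ K) :
    ∃ J ∈ groebnerCircuits (circuits M), IsConvexSubset (dropMin J) K := by
  obtain ⟨c, hc, hcC⟩ := exists_insert_dropMin (nonempty_of_mem_circuits hC)
  -- the upper segment of `K` above the least element of `C`, with that element added
  set T : Finset S := {k ∈ K | c < k}
  have hcT : ∀ b ∈ T, c < b := fun b hb => (Finset.mem_filter.1 hb).2
  have hdep : IsDependent (circuits M) (insert c T) := by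
    refine ⟨C, hC, ?_⟩
    rw [← hcC]
    exact Finset.insert_subset_insert _ fun a ha => Finset.mem_filter.2 ⟨hCK ha, hc a ha⟩
  have hex : ∃ J ∈ groebnerCircuits (circuits M),
      IsConvexSubset (dropMin J) (dropMin (insert c T)) := by
    by_cases hG : IsGroebnerCircuit (circuits M) (insert c T)
    · exact ⟨_, hG, subset_rfl, fun j hj _ _ _ _ _ _ => hj⟩
    · rw [isGroebnerCircuit_iff, not_and] at hG
      have hG := hG hdep
      push Not at hG
      obtain ⟨J, hJ, -, hconv⟩ := hG
      exact ⟨J, hJ, hconv⟩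
  obtain ⟨J, hJ, hconv⟩ := hex
  rw [dropMin_insert hcT] at hconv
  refine ⟨J, hJ, hconv.1.trans (Finset.filter_subset _ _), fun j hj k hk k' hk' hkj hjk' => ?_⟩
  exact hconv.2 j (Finset.mem_filter.2 ⟨hj, (hcT k (hconv.1 hk)).trans hkj⟩) k hk k' hk' hkj hjk'

/-- A word is divisible by the leading monomial of a generator attached to a Gröbner circuit, or of
one of the quadratic generators, unless it is the word of a set containing no broken circuit. -/
theorem exists_leadingMonomial_dvd_or_hasNoBrokenCircuit [Finite S] {R : Type*} [CommRing R]
    [Nontrivial R] (q : R) (M : Matroid S) (m : FreeMonoid S) :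
    (∃ g ∈ generators q (groebnerCircuits (circuits M)), ∃ m₀, IsLeadingMonomial g m₀ ∧
        coefficient g m₀ = 1 ∧ ∃ u v, m = u * m₀ * v) ∨
      ∃ K, HasNoBrokenCircuit (circuits M) K ∧ m = word K := by
  by_cases hchain : (FreeMonoid.toList m).IsChain (· < ·)
  · have hpw := List.isChain_iff_pairwise.1 hchain
    have hnd : (FreeMonoid.toList m).Nodup := hpw.imp fun h => h.ne
    have hm : m = word (FreeMonoid.toList m).toFinset := by
      apply FreeMonoid.toList.injective
      rw [toList_word, (List.toFinset_sort (· ≤ ·) hnd).2 (hpw.imp fun h => h.le)]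
    by_cases hK : HasNoBrokenCircuit (circuits M) (FreeMonoid.toList m).toFinset
    · exact Or.inr ⟨_, hK, hm⟩
    · left
      unfold HasNoBrokenCircuit at hK
      push Not at hK
      obtain ⟨C, hC, hCK⟩ := hK
      obtain ⟨J, hJ, hconv⟩ := exists_groebnerCircuit_of_dropMin_subset hC hCK
      obtain ⟨u, v, huv⟩ := exists_word_eq_mul_of_isConvexSubset hconv
      have hlead := isLeadingMonomial_tMinus q (((isGroebnerCircuit_iff _ _).1 hJ).1.nonempty)
      exact ⟨_, Or.inr ⟨J, hJ, rfl⟩, _, hlead.1, hlead.2, u, v, hm.trans huv⟩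
  · left
    rw [List.isChain_iff_forall_rel_of_append_cons_cons] at hchain
    push Not at hchain
    obtain ⟨a, b, l₁, l₂, hl, hab⟩ := hchain
    have hm : m = FreeMonoid.ofList l₁ * (FreeMonoid.of a * FreeMonoid.of b) *
        FreeMonoid.ofList l₂ := by
      apply FreeMonoid.toList.injective
      simp [hl]
    rcases hab.eq_or_lt with rfl | hab
    · exact ⟨_, Or.inl (Or.inl ⟨b, rfl⟩), _, (isLeadingMonomial_sq q b).1,
        (isLeadingMonomial_sq q b).2, _, _, hm⟩
    · exact ⟨_, Or.inl (Or.inr ⟨a, b, hab, rfl⟩), _, (isLeadingMonomial_anticomm q hab).1,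
        (isLeadingMonomial_anticomm q hab).2, _, _, hm⟩

end Irreducible

/-! ### Functionals on a Clifford algebra -/

section Functional

open CliffordAlgebra

variable (R T : Type*) [CommRing R]

/-- The sum of the coordinates. -/
noncomputable def coordSum : (T →₀ R) →ₗ[R] R := Finsupp.linearCombination R fun _ => 1

variable {R}

/-- The bilinear form `(v, w) ↦ q (∑ v_i) (∑ w_i)`. -/
noncomputable def sumForm (q : R) : LinearMap.BilinForm R (T →₀ R) :=
  q • (LinearMap.mul R R).compl₁₂ (coordSum R T) (coordSum R T)

/-- The quadratic form `v ↦ q (∑ v_i)²`, in whose Clifford algebra the basis vectors form a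
Clifford family. -/
noncomputable def sumQuadraticForm (q : R) : QuadraticForm R (T →₀ R) :=
  (sumForm T q).toQuadraticMap

variable {T}

/-- The generators of the Clifford algebra of `sumQuadraticForm`. -/
noncomputable def cliffordGen (q : R) (i : T) : CliffordAlgebra (sumQuadraticForm T q) :=
  CliffordAlgebra.ι _ (Finsupp.single i 1)

theorem isCliffordFamily_cliffordGen (q : R) : IsCliffordFamily q (cliffordGen (T := T) q) where
  sq i := by
    rw [cliffordGen, ι_sq_scalar, Algebra.algebraMap_eq_smul_one]
    simp [sumQuadraticForm, sumForm, coordSum]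
  anticomm i j := by
    rw [cliffordGen, cliffordGen, ι_mul_ι_add_swap, Algebra.algebraMap_eq_smul_one]
    congr 1
    simp [sumQuadraticForm, sumForm, coordSum, QuadraticMap.polar]
    ring

/-- Scalars embed into the Clifford algebra. As the quadratic form comes from a bilinear form, the
Clifford algebra is linearly isomorphic to the exterior algebra even if `2` is not invertible. -/
theorem algebraMap_sumQuadraticForm_injective (q : R) :
    Function.Injective (algebraMap R (CliffordAlgebra (sumQuadraticForm T q))) := fun r s h => by
  have hB : (-sumForm T q).toQuadraticMap = 0 - sumQuadraticForm T q := by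
    ext v
    simp [sumQuadraticForm]
  have h' := congrArg (changeForm hB) h
  rw [changeForm_algebraMap, changeForm_algebraMap] at h'
  exact (ExteriorAlgebra.algebraMap_inj (M := T →₀ R) r s).1 h'

/-- Contraction of an element of the Clifford algebra with the coordinate functionals of the
members of a list, one after the other. -/
noncomputable def contractList (q : R) :
    List T → CliffordAlgebra (sumQuadraticForm T q) →ₗ[R] CliffordAlgebra (sumQuadraticForm T q)
  | [] => LinearMap.id
  | i :: L => contractList q L ∘ₗ contractLeft (Finsupp.lapply i)

/-- The span of the products of generators none of which is the one with index `i`. -/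
noncomputable def spanAvoiding (q : R) (i : T) :
    Submodule R (CliffordAlgebra (sumQuadraticForm T q)) :=
  Submodule.span R {y | ∃ w : List T, i ∉ w ∧ y = (w.map (cliffordGen q)).prod}

theorem cliffordGen_mul_mem_spanAvoiding {q : R} {i j : T} (hij : i ≠ j)
    {y : CliffordAlgebra (sumQuadraticForm T q)} (hy : y ∈ spanAvoiding q i) :
    cliffordGen q j * y ∈ spanAvoiding q i := by
  have h := Submodule.mem_map_of_mem (f := LinearMap.mulLeft R (cliffordGen q j)) hy
  rw [spanAvoiding, Submodule.map_span] at h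
  refine Submodule.span_mono ?_ h
  rintro _ ⟨_, ⟨w, hw, rfl⟩, rfl⟩
  exact ⟨j :: w, by simp [hij, hw], by simp⟩

theorem contractLeft_mem_spanAvoiding {q : R} {i : T} (d : Module.Dual R (T →₀ R))
    {y : CliffordAlgebra (sumQuadraticForm T q)} (hy : y ∈ spanAvoiding q i) :
    contractLeft d y ∈ spanAvoiding q i := by
  suffices h : spanAvoiding q i ≤ (spanAvoiding q i).comap (contractLeft d) from h hy
  refine Submodule.span_le.2 ?_
  rintro _ ⟨w, hw, rfl⟩
  rw [SetLike.mem_coe, Submodule.mem_comap]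
  induction w with
  | nil => simp
  | cons j w ih =>
    simp only [List.mem_cons, not_or] at hw
    rw [List.map_cons, List.prod_cons, cliffordGen, contractLeft_ι_mul]
    exact sub_mem (Submodule.smul_mem _ _ (Submodule.subset_span ⟨w, hw.2, rfl⟩))
      (cliffordGen_mul_mem_spanAvoiding hw.1 (ih hw.2))

theorem contractLeft_eq_zero_of_mem_spanAvoiding {q : R} {i : T}
    {y : CliffordAlgebra (sumQuadraticForm T q)} (hy : y ∈ spanAvoiding q i) :
    contractLeft (Finsupp.lapply i) y = 0 := by
  suffices h : spanAvoiding q i ≤ LinearMap.ker (contractLeft (Finsupp.lapply i)) from h hy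
  refine Submodule.span_le.2 ?_
  rintro _ ⟨w, hw, rfl⟩
  rw [SetLike.mem_coe, LinearMap.mem_ker]
  induction w with
  | nil => simp
  | cons j w ih =>
    simp only [List.mem_cons, not_or] at hw
    rw [List.map_cons, List.prod_cons, cliffordGen, contractLeft_ι_mul, ih hw.2]
    simp [Ne.symm hw.1]

theorem contractList_eq_zero_of_mem_spanAvoiding {q : R} {i : T} {L : List T} (hi : i ∈ L)
    {y : CliffordAlgebra (sumQuadraticForm T q)} (hy : y ∈ spanAvoiding q i) :
    contractList q L y = 0 := by
  induction L generalizing y with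
  | nil => simp at hi
  | cons j L ih =>
    rw [contractList, LinearMap.comp_apply]
    rcases List.mem_cons.1 hi with rfl | hi
    · rw [contractLeft_eq_zero_of_mem_spanAvoiding hy, map_zero]
    · exact ih hi (contractLeft_mem_spanAvoiding _ hy)

theorem contractList_prod_eq_zero (q : R) {i : T} {L w : List T} (hi : i ∈ L) (hw : i ∉ w) :
    contractList q L (w.map (cliffordGen q)).prod = 0 :=
  contractList_eq_zero_of_mem_spanAvoiding hi (Submodule.subset_span ⟨w, hw, rfl⟩)

theorem contractList_prod_self (q : R) {L : List T} (hL : L.Nodup) :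
    contractList q L (L.map (cliffordGen q)).prod = 1 := by
  induction L with
  | nil => simp [contractList]
  | cons i L ih =>
    rw [List.nodup_cons] at hL
    have h0 : contractLeft (Finsupp.lapply i) (L.map (cliffordGen q)).prod = 0 :=
      contractLeft_eq_zero_of_mem_spanAvoiding (Submodule.subset_span ⟨L, hL.1, rfl⟩)
    rw [contractList, LinearMap.comp_apply, List.map_cons, List.prod_cons, cliffordGen,
      contractLeft_ι_mul, h0]
    simp [ih hL.2]

end Functional

/-! ### The chain of flats of a set without broken circuits -/

section Strata

variable {S : Type*} [LinearOrder S] (M : Matroid S) (K : Finset S)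

/-- The closure of the elements of `K` that are at least `k`. -/
def upperFlat (k : S) : Set S := M.closure {k' | k' ∈ K ∧ k ≤ k'}

open Classical in
/-- The stratum of `s` with respect to the chain of flats `upperFlat M K k` for `k ∈ K`, which
decrease as `k` increases: the largest `k` such that `s` lies in the flat of `k`, or `⊥` if `s` is
not in the closure of `K`. -/
noncomputable def stratum (s : S) : WithBot S := ({k ∈ K | s ∈ upperFlat M K k} : Finset S).max

variable {M K}

theorem upperFlat_antitone : Antitone (upperFlat M K) := fun _ _ h =>
  M.closure_subset_closure fun _ hk => ⟨hk.1, h.trans hk.2⟩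

theorem mem_upperFlat_of_stratum_eq {s k : S} (h : stratum M K s = k) :
    k ∈ K ∧ s ∈ upperFlat M K k := by
  classical
  exact Finset.mem_filter.1 (Finset.mem_of_max h)

theorem le_stratum {s k : S} (hk : k ∈ K) (hs : s ∈ upperFlat M K k) :
    (k : WithBot S) ≤ stratum M K s := by
  classical
  exact Finset.le_max (Finset.mem_filter.2 ⟨hk, hs⟩)

/-- If `K` contains no broken circuit, then `k` is the least element of its flat: a smaller element
of the flat would be the least element of a circuit that is otherwise contained in `K`. -/
theorem HasNoBrokenCircuit.le_of_mem_upperFlat (hK : HasNoBrokenCircuit (circuits M) K)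
    {k s : S} (hs : s ∈ upperFlat M K k) : k ≤ s := by
  by_contra! hlt
  obtain ⟨C, hCsub, hC, hsC⟩ := Matroid.exists_isCircuit_of_mem_closure hs
    fun h => hlt.not_ge h.2
  have hfin : C.Finite := by
    refine Set.Finite.subset ((K.finite_toSet).insert s) (hCsub.trans ?_)
    exact Set.insert_subset_insert fun a ha => ha.1
  refine hK hfin.toFinset (by simpa [circuits] using hC) fun a ha => ?_
  simp only [dropMin, Finset.mem_filter, Set.Finite.mem_toFinset] at ha
  obtain ⟨haC, b, hb, hba⟩ := ha
  rcases hCsub haC with rfl | ha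
  · rcases hCsub hb with rfl | hb
    · exact absurd hba (lt_irrefl _)
    · exact absurd (hba.trans hlt) hb.2.not_gt
  · exact ha.1

theorem HasNoBrokenCircuit.stratum_le (hK : HasNoBrokenCircuit (circuits M) K) (s : S) :
    stratum M K s ≤ s := by
  cases h : stratum M K s with
  | bot => exact bot_le
  | coe k => exact WithBot.coe_le_coe.2 (hK.le_of_mem_upperFlat (mem_upperFlat_of_stratum_eq h).2)

theorem HasNoBrokenCircuit.stratum_eq (hK : HasNoBrokenCircuit (circuits M) K)
    (hE : M.E = Set.univ) {k : S} (hk : k ∈ K) : stratum M K k = k :=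
  (hK.stratum_le k).antisymm
    (le_stratum hk (M.subset_closure _ (by simp [hE]) ⟨hk, le_rfl⟩))

/-- Two elements of each circuit lie in the same stratum: otherwise the element of lowest stratum
would lie in the closure of the others, hence in a higher stratum. -/
theorem exists_stratum_eq_of_isCircuit (hl : M.Loopless) {C : Finset S} (hC : C ∈ circuits M) :
    ∃ c ∈ C, ∃ c' ∈ C, c ≠ c' ∧ stratum M K c = stratum M K c' := by
  by_contra! hinj
  obtain ⟨c, hc, hmin⟩ := C.exists_min_image (stratum M K) (nonempty_of_mem_circuits hC)
  have hlt : ∀ c' ∈ C.erase c, stratum M K c < stratum M K c' := fun c' hc' => by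
    have h := Finset.mem_erase.1 hc'
    exact lt_of_le_of_ne (hmin c' h.2) (hinj c hc c' h.2 h.1.symm)
  have hne : (C.erase c).Nonempty := by
    have hnt := Matroid.loopless_iff_forall_isCircuit.1 hl _ hC
    obtain ⟨c', hc', hcc'⟩ := hnt.exists_ne c
    exact ⟨c', Finset.mem_erase.2 ⟨hcc', hc'⟩⟩
  obtain ⟨d, hd, hdmin⟩ := (C.erase c).exists_min_image (stratum M K) hne
  obtain ⟨k, hk⟩ := WithBot.ne_bot_iff_exists.1 (ne_bot_of_gt (hlt d hd))
  have hmem := mem_upperFlat_of_stratum_eq hk.symm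
  have hsub : (C : Set S) \ {c} ⊆ upperFlat M K k := fun c' hc' => by
    have hc'' : c' ∈ C.erase c := Finset.mem_erase.2 ⟨hc'.2, hc'.1⟩
    have hle := hdmin c' hc''
    obtain ⟨k', hk'⟩ := WithBot.ne_bot_iff_exists.1 (ne_bot_of_gt (hlt c' hc''))
    rw [← hk, ← hk', WithBot.coe_le_coe] at hle
    exact upperFlat_antitone hle (mem_upperFlat_of_stratum_eq hk'.symm).2
  have hcl : c ∈ M.closure (upperFlat M K k) :=
    M.closure_subset_closure hsub (Matroid.IsCircuit.mem_closure_sdiff_singleton_of_mem hC hc)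
  rw [upperFlat, M.closure_closure] at hcl
  have hle := (le_stratum hmem.1 hcl).trans_lt (hlt d hd)
  rw [hk] at hle
  exact lt_irrefl _ hle

/-- Among the words with a letter in each of the strata indexed by the increasing list `L`, that
list is the lexicographically least one of its length. -/
theorem not_lex_of_map_perm {σ : S → WithBot S} (hσ : ∀ s, σ s ≤ s) {L w : List S}
    (hL : L.Pairwise (· < ·)) (hfix : ∀ k ∈ L, σ k = k)
    (hperm : (w.map σ).Perm (L.map (WithBot.some : S → WithBot S))) : ¬ List.Lex (· < ·) w L := by
  induction L generalizing w with
  | nil => intro h; cases h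
  | cons k L ih =>
    cases w with
    | nil => simpa using hperm.length_eq
    | cons s w =>
      rw [List.pairwise_cons] at hL
      have hks : k ≤ s := by
        have hmem : σ s ∈ (k :: L).map (WithBot.some : S → WithBot S) :=
          hperm.mem_iff.1 (by simp)
        obtain ⟨k', hk', hσk⟩ := List.mem_map.1 hmem
        have hle : k' ≤ s := WithBot.coe_le_coe.1 (hσk.le.trans (hσ s))
        rcases List.mem_cons.1 hk' with rfl | hk'
        · exact hle
        · exact (hL.1 k' hk').le.trans hle
      intro hlex
      cases hlex with
      | rel h => exact h.not_ge hks
      | cons h =>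
        rw [List.map_cons, List.map_cons, hfix k (by simp), List.perm_cons] at hperm
        exact ih hL.2 (fun k hk => hfix k (List.mem_cons_of_mem _ hk)) hperm h

theorem exists_notMem_map_of_shortlex {σ : S → WithBot S} (hσ : ∀ s, σ s ≤ s) {L w : List S}
    (hL : L.Pairwise (· < ·)) (hfix : ∀ k ∈ L, σ k = k)
    (hlt : List.Shortlex (· < ·) w L) : ∃ k ∈ L, (k : WithBot S) ∉ w.map σ := by
  by_contra! hall
  have hnd : (L.map (WithBot.some : S → WithBot S)).Nodup :=
    List.Nodup.map WithBot.coe_injective (hL.imp fun h => h.ne)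
  have hsub : (L.map (WithBot.some : S → WithBot S)).Subperm (w.map σ) := by
    refine List.subperm_of_subset hnd fun a ha => ?_
    obtain ⟨k, hk, rfl⟩ := List.mem_map.1 ha
    exact hall k hk
  have hlen := hsub.length_le
  rw [List.length_map, List.length_map] at hlen
  rcases List.shortlex_def.1 hlt with h | ⟨h, hlex⟩
  · omega
  · refine not_lex_of_map_perm hσ hL hfix (hsub.perm_of_length_le ?_).symm hlex
    simp [h]

end Strata

/-! ### Leading monomials of the ideal -/

section Groebner

variable {S R : Type*} [LinearOrder S] [CommRing R]

/-- The word of a set without broken circuits is not the leading monomial of an element of the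
ideal: identifying the variables of equal stratum and contracting with `K` gives a functional that
vanishes on the ideal and on all smaller words, but not on the word of `K`. -/
theorem HasNoBrokenCircuit.not_isLeadingMonomial {M : Matroid S} (hE : M.E = Set.univ)
    (hl : M.Loopless) {q : R} {K : Finset S} (hK : HasNoBrokenCircuit (circuits M) K)
    {f : FreeAlgebra R S} (hf : f ∈ idealI q (circuits M)) :
    ¬ IsLeadingMonomial f (word K) := by
  intro hlead
  set φ : FreeAlgebra R S →ₐ[R] CliffordAlgebra (sumQuadraticForm (WithBot S) q) :=
    FreeAlgebra.lift R fun s => cliffordGen q (stratum M K s) with hφ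
  have hφι : (fun s => φ (FreeAlgebra.ι R s)) = fun s => cliffordGen q (stratum M K s) := by
    funext s
    simp [hφ]
  have hcl : IsCliffordFamily q fun s => cliffordGen q (stratum M K s) :=
    ⟨fun s => (isCliffordFamily_cliffordGen q).sq _,
      fun r s => (isCliffordFamily_cliffordGen q).anticomm _ _⟩
  have hφf : φ f = 0 := by
    refine map_eq_zero_of_mem_idealI φ (map_mem_generators φ (hφι ▸ hcl) fun C hC => ?_) hf
    obtain ⟨c, hc, c', hc', hne, heq⟩ := exists_stratum_eq_of_isCircuit (K := K) hl hC
    rw [map_tMinus, hφι]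
    exact hcl.snd_signedPair_sort_eq_zero_of_eq hc hc' hne (by rw [heq])
  have hφw : ∀ w : FreeMonoid S, φ (monomial R w) =
      (((FreeMonoid.toList w).map (stratum M K)).map (cliffordGen q)).prod := by
    intro w
    induction w using FreeMonoid.inductionOn' with
    | one => simp
    | of_mul a w ih =>
      rw [monomial_of_mul, map_mul, ih]
      simp [hφ]
  set L := K.sort (· ≤ ·)
  have hLpw : L.Pairwise (· < ·) := (Finset.sortedLT_sort K).pairwise
  have hfix : ∀ k ∈ L, stratum M K k = k := fun k hk =>
    hK.stratum_eq hE ((Finset.mem_sort _).1 hk)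
  set D := contractList q (L.map (WithBot.some : S → WithBot S))
  have hone : D (φ (monomial R (word K))) = 1 := by
    have hmap : (FreeMonoid.toList (word K)).map (stratum M K) =
        L.map (WithBot.some : S → WithBot S) := List.map_congr_left hfix
    rw [hφw, hmap]
    exact contractList_prod_self q
      (List.Nodup.map WithBot.coe_injective (Finset.sort_nodup _ _))
  have hzero : ∀ w, WordLT w (word K) → D (φ (monomial R w)) = 0 := fun w hw => by
    obtain ⟨k, hk, hkw⟩ := exists_notMem_map_of_shortlex hK.stratum_le hLpw hfix hw
    rw [hφw]
    exact contractList_prod_eq_zero q (List.mem_map_of_mem hk) hkw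
  obtain ⟨s, hs0, hs⟩ := exists_eq_sum_coefficient_smul_monomial f
  have hD : D (φ f) = coefficient f (word K) • 1 := by
    conv_lhs => rw [hs]
    simp only [map_sum, map_smul]
    rw [Finset.sum_eq_single (word K), hone]
    · intro w _ hw
      by_cases h0 : coefficient f w = 0
      · rw [h0, zero_smul]
      · rw [hzero w (hlead.2 w h0 hw), smul_zero]
    · intro hn
      rw [hs0 _ hn, zero_smul]
  rw [hφf, map_zero, ← Algebra.algebraMap_eq_smul_one] at hD
  exact hlead.1 (algebraMap_sumQuadraticForm_injective q (by rw [← hD, map_zero]))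

theorem isGroebnerBasis_groebnerCircuits [Finite S] {M : Matroid S} (hE : M.E = Set.univ)
    (hl : M.Loopless) (q : R) :
    IsGroebnerBasis (generators q (groebnerCircuits (circuits M)))
      (idealI q (circuits M)) := by
  have hsub : generators q (groebnerCircuits (circuits M)) ⊆
      (idealI q (circuits M) : Set (FreeAlgebra R S)) := by
    rw [idealI_circuits_eq_idealI_groebnerCircuits]
    exact TwoSidedIdeal.subset_span
  refine ⟨hsub, le_antisymm ?_ ?_⟩
  · refine TwoSidedIdeal.span_mono ?_
    rintro _ ⟨f, hf, m, hm, rfl⟩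
    exact ⟨f, hsub hf, m, hm, rfl⟩
  · refine TwoSidedIdeal.span_le.2 ?_
    rintro _ ⟨f, hf, m, hm, rfl⟩
    have : Nontrivial R := ⟨_, _, hm.1⟩
    rcases exists_leadingMonomial_dvd_or_hasNoBrokenCircuit q M m with
      ⟨g, hg, m₀, hm₀, hone, u, v, rfl⟩ | ⟨K, hK, rfl⟩
    · have hmem : monomial R m₀ ∈ TwoSidedIdeal.span
          (leadingTerms (generators q (groebnerCircuits (circuits M)))) :=
        TwoSidedIdeal.subset_span ⟨g, hg, m₀, hm₀, by rw [hone, one_smul]⟩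
      rw [map_mul, map_mul, ← smul_mul_assoc, ← smul_mul_assoc]
      exact TwoSidedIdeal.mul_mem_right _ _ _ (TwoSidedIdeal.mul_mem_left _ _ _ hmem)
    · exact absurd hm (hK.not_isLeadingMonomial hE hl hf)

end Groebner

end OrlikSolomon

/-- `M` is a matroid on the finite totally ordered set `S` without loops and without parallel
elements. -/
theorem theorem1p1 {S : Type*} [LinearOrder S] [Finite S]
    (M : Matroid S) (hE : M.E = Set.univ) (hloopless : M.Loopless)
    (hparallel : ∀ a b : S, a ≠ b → ¬ M.IsCircuit {a, b})
    {R : Type*} [CommRing R] (q : R) :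
    OrlikSolomon.idealI q (OrlikSolomon.circuits M) =
        OrlikSolomon.idealI q (OrlikSolomon.groebnerCircuits (OrlikSolomon.circuits M)) ∧
      OrlikSolomon.IsGroebnerBasis
        (OrlikSolomon.generators q (OrlikSolomon.groebnerCircuits (OrlikSolomon.circuits M)))
        (OrlikSolomon.idealI q (OrlikSolomon.circuits M)) := by
  exact ⟨OrlikSolomon.idealI_circuits_eq_idealI_groebnerCircuits M q,
    OrlikSolomon.isGroebnerBasis_groebnerCircuits hE hloopless q⟩
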